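/- Let $\Sigma=\{0,1,\$\}$. A nondeterministic Büchi automaton (NBA) $\mathcal A=(\Sigma,Q,q_0,\delta,F)$ has a finite state set $Q$, an initial state $q_0$, a transition function $\delta:Q\times\Sigma\to 2^Q$ and final states $F\subseteq Q$; an infinite word is in its language $L(\mathcal A)$ if some run on it visits some state of $F$ infinitely often. A state $q$ is a sink if $\delta(q,\sigma)=\{q\}$ for all $\sigma\in\Sigma$. A reachability automaton has exactly one final state, which is a sink; in a safety automaton all states are final. A finite MDP $\mathcal M$ labelled by $\Sigma$ has finite sets $S$ of states and $Act$ of actions and a partial function $P:S\times Act\times\Sigma\rightharpoonup\mathrm{SubDist}(S)$ with $\sum_{\sigma,s'}P(s,m,\sigma)(s')\le 1$ for all $s,m$ (missing probability is the probability that the run is lost). Strategies may be randomised and depend on the history. $\mathrm{PSem}^{\mathcal M}_{\mathcal A}(s_0)$ is the supremum over strategies of the probability that the infinite run of $\mathcal M$ from $s_0$ produces a word in $L(\mathcal A)$. In the product $\mathcal M\times\mathcal A$ the strategy also resolves the nondeterminism of $\mathcal A$ on the fly: in every step it chooses a successor $q'\in\delta(q,\sigma)$ of the current automaton state $q$ for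 the letter $\sigma$ and state $s'$ that the step produces (if it does not, the run is lost), depending only on the history up to and including this step. $\mathrm{PSyn}^{\mathcal M}_{\mathcal A}(s_0)$ is the supremum over the strategies of the product of the probability that the run from $(s_0,q_0)$ visits some state of $S\times F$ infinitely often. The NBA $\mathcal A$ is good-for-MDPs (GfM) if $\mathrm{PSyn}^{\mathcal M}_{\mathcal A}(s_0)=\mathrm{PSem}^{\mathcal M}_{\mathcal A}(s_0)$ for every finite MDP $\mathcal M$ and initial state $s_0$. For $n\ge 1$ let $$L_n=\{0,1\}^*1\{0,1\}^{n-1}\$,\qquad L_n^r=\{w\beta : w\in L_n,\ \beta\in\Sigma^\omega\},\qquad L_n^s=\{w\$^\omega : w\in L_n\}\cup\{0,1\}^\omega .$$ Let $\mathcal R_n$ be the automaton with states $q_0,\dots,q_n,f$, initial state $q_0$, the single final state $f$, and exactly the transitions $q_0\xrightarrow{0,1}q_0$, $q_0\xrightarrow{1}q_1$, $q_i\xrightarrow{0,1}q_{i+1}$ for $1\le i<n$, $q_n\xrightarrow{\$}f$ and $f\xrightarrow{0,1,\$}f$. Let $\mathcal S_n$ be the automaton with states $q_0,\dots,q_n$,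 all of them final, initial state $q_0$, and exactly the transitions $q_0\xrightarrow{0,1}q_0$, $q_0\xrightarrow{1}q_1$, $q_i\xrightarrow{0,1}q_{i+1}$ for $1\le i<n$, and $q_n\xrightarrow{\$}q_n$. Then for every $n\ge1$: 1. $\mathcal R_n$ is a reachability automaton with $n+2$ states and $L(\mathcal R_n)=L_n^r$; 2. $\mathcal S_n$ is a safety automaton with $n+1$ states and $L(\mathcal S_n)=L_n^s$; 3. every GfM automaton with language $L_n^r$ or $L_n^s$ has at least $2^n$ states, even when sinks are not counted. Consequently general nondeterministic automata are exponentially more succinct than GfM automata: there is $c>0$ such that for all sufficiently large $m$ there is an NBA $\mathcal N$ over $\Sigma$ with at most $m$ states and at most $m$ transitions such that every GfM automaton with the language $L(\mathcal N)$ has at least $2^{cm}$ states. -/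

import Mathlib

open scoped ENNReal
open Filter MeasureTheory ProbabilityTheory

noncomputable section

/-! ## Automata on infinite words -/

/-- A nondeterministic automaton over the alphabet `α` with states `Q`. The types of letters and
states are taken finite wherever automata are used. -/
structure NBA (α Q : Type) where
  /-- the initial state -/
  init : Q
  /-- the transition function -/
  δ : Q → α → Set Q
  /-- the final states -/
  F : Set Q

namespace NBA

variable {α Q : Type}

/-- `ρ` is a run on the infinite word `w`. -/
def IsRun (A : NBA α Q) (w : ℕ → α) (ρ : ℕ → Q) : Prop :=
  ρ 0 = A.init ∧ ∀ i, ρ (i + 1) ∈ A.δ (ρ i) (w i)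

/-- The Büchi condition: some final state is visited infinitely often (there are only finitely
many states, so this says that final states are visited infinitely often). -/
def Buchi (A : NBA α Q) (ρ : ℕ → Q) : Prop :=
  ∃ q ∈ A.F, ∃ᶠ i in atTop, ρ i = q

/-- The language of infinite words accepted by `A` under the Büchi condition. -/
def language (A : NBA α Q) : Set (ℕ → α) :=
  {w | ∃ ρ, A.IsRun w ρ ∧ A.Buchi ρ}

/-- The state `q` is a sink. -/
def IsSink (A : NBA α Q) (q : Q) : Prop :=
  ∀ a, A.δ q a = {q}

/-- A reachability automaton: there is a single final state, and it is a sink. -/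
def IsReachability (A : NBA α Q) : Prop :=
  ∃ f, A.F = {f} ∧ A.IsSink f

/-- A safety automaton: all states are final. -/
def IsSafety (A : NBA α Q) : Prop :=
  A.F = Set.univ

/-- The number of transitions. -/
def numTransitions (A : NBA α Q) : ℕ :=
  Set.ncard {t : Q × α × Q | t.2.2 ∈ A.δ t.1 t.2.1}

end NBA

/-! ## Markov decision processes -/

/-- A transition-labelled Markov decision process with states `S`, actions `Act` and labels `α`.
`prob s m a` is the subdistribution on successor states for the label `a`, where it is defined
(`none` stands for undefined). Probability that is missing in the total sum is the probability
that the run is lost (an omitted rejecting sink). -/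
structure MDP (α S Act : Type) [Fintype α] [Fintype S] where
  prob : S → Act → α → Option (S → ℝ≥0∞)
  sum_le_one : ∀ s m, ∑ a, ∑ s', (prob s m a).getD 0 s' ≤ 1

/-- The result of one step of an MDP: either `none`, the run is lost, or `some (m, a, s')`, the
action `m` was taken, the label `a` was produced, and the state `s'` was reached. -/
def Outcome (α S Act : Type) : Type := Option (Act × α × S)

instance (α S Act : Type) : MeasurableSpace (Outcome α S Act) := ⊤

instance (α S Act : Type) : DiscreteMeasurableSpace (Outcome α S Act) := ⟨fun _ => trivial⟩

instance (α S Act : Type) [Finite α] [Finite S] [Finite Act] : Finite (Outcome α S Act) :=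
  inferInstanceAs (Finite (Option (Act × α × S)))

/-- The last state of the finite run that starts in `h.1` and makes the steps `h.2`. -/
def lastState {α S Act : Type} (h : S × List (Act × α × S)) : S :=
  (h.2.getLast?.map fun t => t.2.2).getD h.1

namespace MDP

variable {α S Act : Type} [Fintype α] [Fintype S]

/-- The actions available in `s`. -/
def avail (M : MDP α S Act) (s : S) : Set Act :=
  {m | ∃ a, (M.prob s m a).isSome}

/-- A (randomised, history dependent) strategy assigns to each finite run a distribution on the
actions that are available in its last state. (In a state without available actions every run is
lost, and the value of the strategy is irrelevant.) -/
structure Strategy (M : MDP α S Act) where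
  choose : S × List (Act × α × S) → PMF Act
  support_subset : ∀ h, (M.avail (lastState h)).Nonempty →
    (choose h).support ⊆ M.avail (lastState h)

/-- The distribution of the label and the next state when the action `m` is taken in `s`; `none`
has the missing probability. -/
def transition (M : MDP α S Act) (s : S) (m : Act) : PMF (Option (α × S)) :=
  PMF.ofFintype
    (fun o => o.elim (1 - ∑ a, ∑ s', (M.prob s m a).getD 0 s')
      fun t => (M.prob s m t.1).getD 0 t.2)
    (by
      rw [Fintype.sum_option, Fintype.sum_prod_type]
      exact tsub_add_cancel_of_le (M.sum_le_one s m))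

/-- The distribution of the next step after the finite run `h` under the strategy `μ`. -/
def step (M : MDP α S Act) (μ : M.Strategy) (h : S × List (Act × α × S)) :
    PMF (Outcome α S Act) :=
  (μ.choose h).bind fun m =>
    (M.transition (lastState h) m).map (Option.map fun t => (m, t.1, t.2))

open Classical in
/-- The distribution of the next outcome, from the start state `s` and the list of all outcomes so
far: a lost run stays lost. -/
def next (M : MDP α S Act) (μ : M.Strategy) (s : S) (l : List (Option (Act × α × S))) :
    PMF (Outcome α S Act) :=
  if none ∈ l then PMF.pure none else M.step μ (s, l.reduceOption)

/-- The Markov kernel that produces the outcome number `n + 1` from the outcomes `0, …, n`. -/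
def kernel [Finite Act] (M : MDP α S Act) (μ : M.Strategy) (s : S) (n : ℕ) :
    Kernel ((_ : Finset.Iic n) → Outcome α S Act) (Outcome α S Act) :=
  Kernel.ofFunOfCountable fun x =>
    (M.next μ s (List.ofFn fun i : Fin (n + 1) =>
      x ⟨i, Finset.mem_Iic.2 (Nat.lt_succ_iff.1 i.2)⟩)).toMeasure

instance [Finite Act] (M : MDP α S Act) (μ : M.Strategy) (s : S) (n : ℕ) :
    IsMarkovKernel (M.kernel μ s n) :=
  ⟨fun _ => PMF.toMeasure.isProbabilityMeasure _⟩

/-- The law of the sequence of outcomes under the strategy `μ` from the state `s`, given by the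
Ionescu-Tulcea theorem. -/
def law [Finite Act] (M : MDP α S Act) (μ : M.Strategy) (s : S) :
    Measure (ℕ → Outcome α S Act) :=
  Kernel.trajMeasure (X := fun _ => Outcome α S Act) (M.next μ s []).toMeasure
    (M.kernel μ s)

/-- The probability that the process, started in `s` under the strategy `μ`, makes an infinite run
whose sequence of steps (action, label, next state) lies in `E`. -/
def Pr [Finite Act] (M : MDP α S Act) (μ : M.Strategy) (s : S) (E : Set (ℕ → Act × α × S)) :
    ℝ≥0∞ :=
  M.law μ s {x | ∃ r ∈ E, ∀ n, x n = some (r n)}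

/-- The semantic satisfaction probability: the optimal probability that the word of labels produced
by `M` from `s` is in the language of `A`. -/
def PSem {Q : Type} [Finite Act] (M : MDP α S Act) (A : NBA α Q) (s : S) : ℝ≥0∞ :=
  ⨆ μ : M.Strategy, M.Pr μ s {r | (fun n => (r n).2.1) ∈ A.language}

open Classical in
/-- The product of the MDP `M` and the automaton `A`. An action is a pair of an action `m` of `M`
and a resolution `ρ` of the nondeterminism of `A` in this step: when `M` produces the label `a` and
moves to `s'`, the automaton moves to `ρ a s'`; if `A` does not have this transition, the run is
lost. -/
def product {Q : Type} [Fintype Q] (M : MDP α S Act) (A : NBA α Q) :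
    MDP α (S × Q) (Act × (α → S → Q)) where
  prob p m a := (M.prob p.1 m.1 a).map fun φ p' =>
    if p'.2 = m.2 a p'.1 ∧ p'.2 ∈ A.δ p.2 a then φ p'.1 else 0
  sum_le_one p m := by
    refine le_trans (Finset.sum_le_sum fun a _ => ?_) (M.sum_le_one p.1 m.1)
    cases h : M.prob p.1 m.1 a with
    | none => simp
    | some φ =>
      simp only [Option.map_some, Option.getD_some, Fintype.sum_prod_type]
      refine Finset.sum_le_sum fun s' _ => ?_
      calc ∑ q', (if q' = m.2 a s' ∧ q' ∈ A.δ p.2 a then φ s' else 0)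
          ≤ ∑ q', (if q' = m.2 a s' then φ s' else 0) := by
            refine Finset.sum_le_sum fun q' _ => ?_
            split_ifs <;> simp_all
        _ = φ s' := by simp

/-- The syntactic satisfaction probability: the optimal probability that the run of the product from
`(s, q₀)` satisfies the Büchi condition of the product, that is, visits some state in
`S × F` infinitely often. -/
def PSyn {Q : Type} [Fintype Q] [Finite Act] (M : MDP α S Act) (A : NBA α Q) (s : S) : ℝ≥0∞ :=
  ⨆ μ : (M.product A).Strategy,
    (M.product A).Pr μ (s, A.init) {r | ∃ p : S × Q, p.2 ∈ A.F ∧ ∃ᶠ n in atTop, (r n).2.2 = p}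

end MDP

/-- The automaton `A` is good for MDPs. -/
def NBA.IsGfM {α Q : Type} [Fintype α] [Fintype Q] (A : NBA α Q) : Prop :=
  ∀ (S Act : Type) [Fintype S] [Finite Act] (M : MDP α S Act) (s₀ : S),
    M.PSyn A s₀ = M.PSem A s₀

/-! ## The languages and the automata -/

/-- The alphabet `{0, 1, $}`. -/
inductive Letter where
  | zero
  | one
  | dollar
  deriving DecidableEq

instance : Fintype Letter where
  elems := {Letter.zero, Letter.one, Letter.dollar}
  complete := fun a => by cases a <;> simp

/-- The word `w β`, for a finite word `w` and an infinite word `β`. -/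
def appendWord {α : Type} (w : List α) (β : ℕ → α) : ℕ → α :=
  fun i => (w[i]?).getD (β (i - w.length))

/-- For `1 ≤ n`, the language `{0,1}* 1 {0,1}^(n-1) $`. -/
def langFin (n : ℕ) : Set (List Letter) :=
  {w | ∃ u v : List Letter, Letter.dollar ∉ u ∧ Letter.dollar ∉ v ∧ v.length + 1 = n ∧
    w = u ++ [Letter.one] ++ v ++ [Letter.dollar]}

/-- The reachability language `{w {0,1,$}^ω | w ∈ langFin n}`. -/
def langR (n : ℕ) : Set (ℕ → Letter) :=
  {x | ∃ w ∈ langFin n, ∃ β : ℕ → Letter, x = appendWord w β}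

/-- The safety language `{w $^ω | w ∈ langFin n} ∪ {0,1}^ω`. -/
def langS (n : ℕ) : Set (ℕ → Letter) :=
  {x | ∃ w ∈ langFin n, x = appendWord w fun _ => Letter.dollar} ∪
    {x | ∀ i, x i ≠ Letter.dollar}

/-- The reachability automaton, for `1 ≤ n`. The states `q₀, …, qₙ` are `0, …, n`, and the final
state `f` is `n + 1`. -/
def autR (n : ℕ) : NBA Letter (Fin (n + 2)) where
  init := 0
  δ q a := {p |
    (q.val = 0 ∧ a ≠ Letter.dollar ∧ p.val = 0) ∨
    (q.val = 0 ∧ a = Letter.one ∧ p.val = 1) ∨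
    (1 ≤ q.val ∧ q.val < n ∧ a ≠ Letter.dollar ∧ p.val = q.val + 1) ∨
    (q.val = n ∧ a = Letter.dollar ∧ p.val = n + 1) ∨
    (q.val = n + 1 ∧ p.val = n + 1)}
  F := {Fin.last (n + 1)}

/-- The safety automaton, for `1 ≤ n`. The states `q₀, …, qₙ` are `0, …, n`. -/
def autS (n : ℕ) : NBA Letter (Fin (n + 1)) where
  init := 0
  δ q a := {p |
    (q.val = 0 ∧ a ≠ Letter.dollar ∧ p.val = 0) ∨
    (q.val = 0 ∧ a = Letter.one ∧ p.val = 1) ∨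
    (1 ≤ q.val ∧ q.val < n ∧ a ≠ Letter.dollar ∧ p.val = q.val + 1) ∨
    (q.val = n ∧ a = Letter.dollar ∧ p.val = n)}
  F := Set.univ

end

/-! The lower bound rests on a Markov chain that emits a fixed word `u` of `n` bits and then draws
one of finitely many continuations uniformly. If all resulting words are in the language, the
semantic probability is 1. In the product, the automaton state after `n` letters is fixed before the
draw. If every state missed some continuation, each strategy would fail with probability at least
`1/|I|`, so even the supremum would stay below 1. Hence a GfM automaton has a state `q(u)` through
which all the words have accepting runs (`NBA.IsGfM.exists_common_state`).

The continuation `0^i $^ω` queries bit `i` of `u`, since that bit stands `n` places before the first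
`$`. Take these for all `i` with `u i` true. If `q(u) = q(u')`, splicing a run on `u'` with an
accepting run on `u 0^i $^ω` shows that `u' i` is true too; by symmetry `u = u'`, which gives `2^n`
states. The further continuation `1 0^(n-1) $^ω` is always accepted, while `0^n $^ω` never is, so
`q(u)` is not a sink.

For succinctness, `autR n` has linearly many states and transitions. -/

/-! ### Almost sure behaviour and one-step bounds for the law of an MDP -/

namespace MDP

variable {α S Act : Type} [Fintype α] [Fintype S]

/-- If, whatever the outcomes so far are, the next outcome is in `B` with probability at most `c`,
then the outcome number `n` is in `B` with probability at most `c`. -/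
theorem law_setOf_mem_le [Finite Act] (M : MDP α S Act) (μ : M.Strategy) (s : S) (n : ℕ)
    (B : List (Option (Act × α × S)) → Set (Outcome α S Act)) (c : ℝ≥0∞)
    (h : ∀ l, (M.next μ s l).toMeasure (B l) ≤ c) :
    M.law μ s {x | x n ∈ B (List.ofFn fun i : Fin n => x i)} ≤ c := by
  cases n with
  | zero =>
    have h0 : (M.law μ s).map (fun x => x 0) = (M.next μ s []).toMeasure := by
      have hm := PMF.toMeasure.isProbabilityMeasure (M.next μ s [])
      have e : (fun x : ℕ → Outcome α S Act => x 0) =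
          (fun y : (_ : Finset.Iic 0) → Outcome α S Act => y ⟨0, by simp⟩) ∘
            Preorder.frestrictLe (π := fun _ => Outcome α S Act) 0 := rfl
      rw [e, ← Measure.map_map (by fun_prop) (by fun_prop), law, Kernel.trajMeasure,
        Measure.map_comp _ _ (by fun_prop), Kernel.traj_map_frestrictLe, Kernel.partialTraj_self,
        Measure.id_comp, Measure.map_map (by fun_prop) (by fun_prop)]
      exact Measure.map_id
    have := h []
    rw [← h0, Measure.map_apply (by fun_prop) (Set.toFinite _).measurableSet] at this
    exact this
  | succ n =>
    have hm := PMF.toMeasure.isProbabilityMeasure (M.next μ s [])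
    let T : Set (((_ : Finset.Iic n) → Outcome α S Act) × Outcome α S Act) :=
      {p | p.2 ∈ B (List.ofFn fun i : Fin (n + 1) =>
        p.1 ⟨i, Finset.mem_Iic.2 (Nat.lt_succ_iff.1 i.2)⟩)}
    have hT : MeasurableSet T := (Set.toFinite _).measurableSet
    -- The joint law of the history and the next outcome is a composition product, so the pointwise
    -- bound `h` can be integrated over histories.
    have h1 := Kernel.map_frestrictLe_trajMeasure_compProd_eq_map_trajMeasure
      (X := fun _ => Outcome α S Act) (μ₀ := (M.next μ s []).toMeasure) (κ := M.kernel μ s) (a := n)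
    have h2 : M.law μ s {x | x (n + 1) ∈ B (List.ofFn fun i : Fin (n + 1) => x i)} =
        ((M.law μ s).map (fun x => (Preorder.frestrictLe (π := fun _ => Outcome α S Act) n x,
          x (n + 1)))) T := by
      rw [Measure.map_apply (by fun_prop) hT]
      rfl
    have hp : IsProbabilityMeasure (M.law μ s) := by unfold law; infer_instance
    have hp' : IsProbabilityMeasure
        ((M.law μ s).map (Preorder.frestrictLe (π := fun _ => Outcome α S Act) n)) :=
      Measure.isProbabilityMeasure_map (by fun_prop)
    rw [h2]
    unfold law at hp hp' ⊢
    rw [← h1, Measure.compProd_apply hT]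
    calc _ ≤ ∫⁻ _, c ∂((M.law μ s).map
          (Preorder.frestrictLe (π := fun _ => Outcome α S Act) n)) :=
          lintegral_mono fun x => h _
      _ ≤ c := by
        have : IsProbabilityMeasure ((M.law μ s).map
          (Preorder.frestrictLe (π := fun _ => Outcome α S Act) n)) := hp'
        simp

/-- Almost surely every outcome has positive probability. -/
theorem ae_next_ne_zero [Finite Act] (M : MDP α S Act) (μ : M.Strategy) (s : S) :
    ∀ᵐ x ∂M.law μ s, ∀ n, M.next μ s (List.ofFn fun i : Fin n => x i) (x n) ≠ 0 := by
  rw [ae_all_iff]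
  intro n
  refine le_antisymm ?_ zero_le
  have := M.law_setOf_mem_le μ s n (fun l => {o | M.next μ s l o = 0}) 0 (fun l => by
    rw [nonpos_iff_eq_zero, PMF.toMeasure_apply_eq_zero_iff _ (Set.toFinite _).measurableSet,
      Set.disjoint_left]
    intro o ho h0
    exact ho h0)
  simpa [Set.compl_def] using this

/-- The sequence of states of the infinite run that starts in `s` and makes the steps `r`. -/
def stateSeq (s : S) (r : ℕ → Act × α × S) : ℕ → S
  | 0 => s
  | n + 1 => (r n).2.2

omit [Fintype α] [Fintype S] in
theorem lastState_ofFn (s : S) (r : ℕ → Act × α × S) (n : ℕ) :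
    lastState (s, List.ofFn fun i : Fin n => r i) = stateSeq s r n := by
  cases n with
  | zero => simp [lastState, stateSeq]
  | succ n =>
    have : (List.ofFn fun i : Fin (n + 1) => r i).getLast? = some (r n) := by
      rw [List.getLast?_eq_getElem?, List.length_ofFn, Nat.add_sub_cancel,
        List.getElem?_ofFn, dif_pos n.lt_succ_self]
    simp only [lastState, stateSeq, this, Option.map_some, Option.getD_some]

theorem next_of_notMem (M : MDP α S Act) (μ : M.Strategy) (s : S)
    {l : List (Option (Act × α × S))} (hl : none ∉ l) :
    M.next μ s l = M.step μ (s, l.reduceOption) := by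
  rw [next, if_neg hl]

theorem next_ofFn_some (M : MDP α S Act) (μ : M.Strategy) (s : S) (r : ℕ → Act × α × S) (n : ℕ) :
    M.next μ s (List.ofFn fun i : Fin n => some (r i)) =
      M.step μ (s, List.ofFn fun i : Fin n => r i) := by
  have h1 : (none : Option (Act × α × S)) ∉ List.ofFn fun i : Fin n => some (r i) := by
    simp [List.mem_ofFn]
  have h2 : (List.ofFn fun i : Fin n => some (r i)) = (List.ofFn fun i : Fin n => r i).map some := by
    rw [List.map_ofFn]; rfl
  rw [M.next_of_notMem μ s h1, h2]
  congr 2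
  simp [List.reduceOption]

theorem exists_transition_ne_zero {M : MDP α S Act} {μ : M.Strategy} {h : S × List (Act × α × S)}
    {o : Outcome α S Act} (ho : M.step μ h o ≠ 0) :
    ∃ m o', M.transition (lastState h) m o' ≠ 0 ∧
      (Option.map (fun t => ((m, t.1, t.2) : Act × α × S)) o' : Outcome α S Act) = o := by
  obtain ⟨m, -, hm⟩ := (PMF.mem_support_bind_iff _ _ _).1 ((PMF.mem_support_iff _ _).2 ho)
  obtain ⟨o', ho', e⟩ := (PMF.mem_support_map_iff _ _ _).1 hm
  exact ⟨m, o', (PMF.mem_support_iff _ _).1 ho', e⟩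

theorem prob_ne_zero_of_step_ne_zero {M : MDP α S Act} {μ : M.Strategy}
    {h : S × List (Act × α × S)}
    {t : Act × α × S} (ht : M.step μ h (some t : Option _) ≠ 0) :
    (M.prob (lastState h) t.1 t.2.1).getD 0 t.2.2 ≠ 0 := by
  obtain ⟨m, o, ho, e⟩ := exists_transition_ne_zero ht
  cases o with
  | none => exact absurd e (Option.some_ne_none t).symm
  | some o =>
    have e' : (m, o.1, o.2) = t := Option.some.inj e
    subst e'
    exact ho

/-- Almost surely an infinite run makes only steps of positive probability. -/
theorem ae_prob_ne_zero [Finite Act] (M : MDP α S Act) (μ : M.Strategy) (s : S) :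
    ∀ᵐ x ∂M.law μ s, ∀ r : ℕ → Act × α × S, (∀ n, x n = some (r n)) → ∀ n,
      (M.prob (stateSeq s r n) (r n).1 (r n).2.1).getD 0 (r n).2.2 ≠ 0 := by
  filter_upwards [M.ae_next_ne_zero μ s] with x hx r hr n
  have h1 := hx n
  obtain rfl : x = fun n => some (r n) := funext hr
  have h2 : M.step μ (s, List.ofFn fun i : Fin n => r i) (some (r n) : Option _) ≠ 0 := by
    rw [← M.next_ofFn_some μ s r n]; exact h1
  have h3 := prob_ne_zero_of_step_ne_zero h2
  rwa [lastState_ofFn] at h3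

/-- If no probability is missing, then almost surely the run is infinite. -/
theorem ae_exists_run [Finite Act] (M : MDP α S Act) (μ : M.Strategy) (s : S)
    (hM : ∀ s m, ∑ a, ∑ s', (M.prob s m a).getD 0 s' = 1) :
    ∀ᵐ x ∂M.law μ s, ∃ r : ℕ → Act × α × S, ∀ n, x n = some (r n) := by
  filter_upwards [M.ae_next_ne_zero μ s] with x hx
  -- A first loss would be a genuine step with outcome `none`, whose probability is the missing
  -- mass, here 0.
  have key : ∀ n, x n ≠ (none : Option (Act × α × S)) := by
    intro n
    induction n using Nat.strong_induction_on with
    | _ n ih =>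
      intro h0
      have h1 := hx n
      have hn : ¬ (none : Option (Act × α × S)) ∈ List.ofFn fun i : Fin n => (x i : Option _) := by
        intro h
        obtain ⟨i, hi⟩ := (List.mem_ofFn (f := fun i : Fin n => (x i : Option _))).1 h
        exact ih i i.2 hi
      erw [M.next_of_notMem μ s hn, h0] at h1
      obtain ⟨m, o, ho, e⟩ := exists_transition_ne_zero h1
      cases o with
      | some o => exact absurd e (Option.some_ne_none _)
      | none =>
        refine ho ?_
        change 1 - _ = (0 : ℝ≥0∞)
        rw [hM, tsub_self]
  choose r hr using fun n => Option.ne_none_iff_exists'.1 (key n)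
  exact ⟨r, hr⟩

open Classical in
-- A randomised strategy only averages over actions, so a bound valid for every single action
-- survives.
theorem step_toMeasure_le [Finite Act] (M : MDP α S Act) (μ : M.Strategy)
    (h : S × List (Act × α × S)) (D : Set (α × S)) (c : ℝ≥0∞)
    (hc : ∀ m, ∑ t ∈ Finset.univ.filter (· ∈ D), (M.prob (lastState h) m t.1).getD 0 t.2 ≤ c) :
    (M.step μ h).toMeasure {o | ∃ t : Act × α × S, o = (some t : Option _) ∧ t.2 ∈ D} ≤ c := by
  rw [step, PMF.toMeasure_bind_apply _ _ _ (Set.toFinite _).measurableSet]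
  have hm : ∀ m, ((M.transition (lastState h) m).map
      (Option.map fun t => ((m, t.1, t.2) : Act × α × S)) : PMF (Outcome α S Act)).toMeasure
        {o | ∃ t : Act × α × S, o = (some t : Option _) ∧ t.2 ∈ D} ≤ c := by
    intro m
    rw [PMF.toMeasure_apply_eq_toOuterMeasure_apply _ (Set.toFinite _).measurableSet]
    refine (PMF.toOuterMeasure_map_apply _ _ _).trans_le ?_
    have e : (Option.map fun t : α × S => ((m, t.1, t.2) : Act × α × S)) ⁻¹'
        {o | ∃ t : Act × α × S, o = (some t : Option _) ∧ t.2 ∈ D} =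
        ↑((Finset.univ.filter (· ∈ D)).image (some : α × S → Option (α × S))) := by
      ext o
      rcases o with _ | ⟨a, b⟩ <;> simp [-Prod.exists]
    refine le_trans (le_of_eq ?_) (hc m)
    erw [e]
    rw [PMF.toOuterMeasure_apply_finset, Finset.sum_image (by simp)]
    rfl
  calc _ ≤ ∑' m, μ.choose h m * c := ENNReal.tsum_le_tsum fun m => by gcongr; exact hm m
    _ = c := by rw [ENNReal.tsum_mul_right, PMF.tsum_coe, one_mul]

open Classical in
/-- An upper bound for the probability of an event that restricts the step number `n`. -/
theorem Pr_le [Finite Act] (M : MDP α S Act) (μ : M.Strategy) (s : S) (n : ℕ)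
    (D : S → Set (α × S)) (c : ℝ≥0∞)
    (hc : ∀ p m, ∑ t ∈ Finset.univ.filter (· ∈ D p), (M.prob p m t.1).getD 0 t.2 ≤ c)
    (E : Set (ℕ → Act × α × S))
    (hE : ∀ r ∈ E, (∀ k, (M.prob (stateSeq s r k) (r k).1 (r k).2.1).getD 0 (r k).2.2 ≠ 0) →
      (r n).2 ∈ D (stateSeq s r n)) :
    M.Pr μ s E ≤ c := by
  refine le_trans (measure_mono_ae ?_) (M.law_setOf_mem_le μ s n
    (fun l => if none ∈ l then ∅ else {o | ∃ t : Act × α × S, o = (some t : Option _) ∧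
      t.2 ∈ D (lastState (s, l.reduceOption))}) c ?_)
  · filter_upwards [M.ae_prob_ne_zero μ s] with x hx
    rintro ⟨r, hr, hxr⟩
    have h1 := hE r hr (hx r hxr)
    obtain rfl : x = fun n => some (r n) := funext hxr
    have hn : (none : Option (Act × α × S)) ∉ List.ofFn fun i : Fin n => some (r i) := by
      simp [List.mem_ofFn]
    have h2 : (List.ofFn fun i : Fin n => some (r i)) =
        (List.ofFn fun i : Fin n => r i).map some := by
      rw [List.map_ofFn]; rfl
    have h3 : (List.ofFn fun i : Fin n => some (r i)).reduceOption =
        List.ofFn fun i : Fin n => r i := by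
      rw [h2]; simp [List.reduceOption]
    change _ ∈ _
    erw [if_neg hn]
    refine ⟨r n, rfl, ?_⟩
    rw [h3, lastState_ofFn]
    exact h1
  · intro l
    by_cases hl : none ∈ l
    · simp [hl]
    · rw [M.next_of_notMem μ s hl, if_neg hl]
      exact M.step_toMeasure_le μ _ _ c fun m => hc _ m

end MDP

/-! ### The branching Markov chain -/

open Classical in
/-- A Markov chain for the family of words `x`: it produces letters of the current word, except
that after `n` letters a uniformly random word of the family is chosen and the chain
goes on with it. After `N` letters, the letter number `N` is repeated forever. -/
noncomputable def branchingChain {α I : Type} [Fintype α] [Fintype I] [Nonempty I]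
    (x : I → ℕ → α) (n N : ℕ) : MDP α (Fin (N + 1) × I) Unit where
  prob p _ a := some fun p' =>
    if a = x p'.2 p.1 then
      if p'.1 = ⟨min (p.1.val + 1) N, Nat.lt_succ_of_le (min_le_right _ _)⟩ then
        if p.1.val = n then (Fintype.card I : ℝ≥0∞)⁻¹ else if p'.2 = p.2 then 1 else 0
      else 0
    else 0
  sum_le_one p m := by
    simp only [Option.getD_some]
    rw [Finset.sum_comm]
    simp only [Finset.sum_ite_eq', Finset.mem_univ, if_true, Fintype.sum_prod_type_right]
    by_cases h : p.1.val = n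
    · simp only [h, if_true, Finset.sum_const, Finset.card_univ, nsmul_eq_mul]
      rw [ENNReal.mul_inv_cancel (by simp) (by simp)]
    · simp [h]

namespace branchingChain

variable {α I : Type} [Fintype α] [Fintype I] [Nonempty I] (x : I → ℕ → α) (n N : ℕ)

open Classical in
theorem prob_getD (p p' : Fin (N + 1) × I) (m : Unit) (a : α) :
    ((branchingChain x n N).prob p m a).getD 0 p' =
      if a = x p'.2 p.1 then
        if p'.1 = ⟨min (p.1.val + 1) N, Nat.lt_succ_of_le (min_le_right _ _)⟩ then
          if p.1.val = n then (Fintype.card I : ℝ≥0∞)⁻¹ else if p'.2 = p.2 then 1 else 0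
        else 0
      else 0 := rfl

theorem sum_prob (p : Fin (N + 1) × I) (m : Unit) :
    ∑ a, ∑ p', ((branchingChain x n N).prob p m a).getD 0 p' = 1 := by
  classical
  simp only [prob_getD]
  rw [Finset.sum_comm]
  simp only [Finset.sum_ite_eq', Finset.mem_univ, if_true, Fintype.sum_prod_type_right]
  by_cases h : p.1.val = n
  · simp only [h, if_true, Finset.sum_const, Finset.card_univ, nsmul_eq_mul]
    rw [ENNReal.mul_inv_cancel (by simp) (by simp)]
  · simp [h]

variable {x n N}

theorem of_prob_ne_zero {p p' : Fin (N + 1) × I} {m : Unit} {a : α}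
    (h : ((branchingChain x n N).prob p m a).getD 0 p' ≠ 0) :
    a = x p'.2 p.1 ∧ p'.1.val = min (p.1.val + 1) N ∧ (p.1.val ≠ n → p'.2 = p.2) := by
  classical
  rw [prob_getD] at h
  split_ifs at h with h1 h2 h3 h4
  · exact ⟨h1, by rw [h2], fun h => absurd h3 h⟩
  · exact ⟨h1, by rw [h2], fun _ => h4⟩
  all_goals exact absurd rfl h

/-- A path of positive probability: its state number `n` is at position `n`, and its word is the
word of the family that was chosen at position `n`. -/
theorem path_spec (hnN : n < N) (hx : ∀ i i' k, k < n → x i k = x i' k)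
    (hc : ∀ i k, N ≤ k → x i k = x i N) (p : ℕ → Fin (N + 1) × I) (a : ℕ → α)
    (h0 : (p 0).1.val = 0)
    (h : ∀ k, ((branchingChain x n N).prob (p k) () (a k)).getD 0 (p (k + 1)) ≠ 0) :
    (p n).1.val = n ∧ ∀ k, a k = x (p (n + 1)).2 k := by
  have hpos : ∀ k, (p k).1.val = min k N := by
    intro k
    induction k with
    | zero => simp [h0]
    | succ k ih => rw [(of_prob_ne_zero (h k)).2.1, ih]; omega
  have hidx : ∀ k, (p (n + 1 + k)).2 = (p (n + 1)).2 := by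
    intro k
    induction k with
    | zero => rfl
    | succ k ih =>
      rw [← ih]
      exact (of_prob_ne_zero (h (n + 1 + k))).2.2 (by rw [hpos]; omega)
  refine ⟨by rw [hpos]; omega, fun k => ?_⟩
  rw [(of_prob_ne_zero (h k)).1, hpos]
  -- Before `n` the index is irrelevant because the words agree. The step at `n` already emits the
  -- letter of the newly drawn index, which is never changed again; past `N` the position is
  -- clipped, but there the words are constant.
  rcases lt_or_ge k n with hk | hk
  · rw [min_eq_left (by omega)]
    exact hx _ _ _ hk
  · obtain ⟨d, rfl⟩ := Nat.exists_eq_add_of_le hk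
    have := hidx d
    rw [show n + d + 1 = n + 1 + d by omega, this]
    rcases le_total (n + d) N with hN | hN
    · rw [min_eq_left hN]
    · rw [min_eq_right hN, hc _ _ hN]

/-- There is a single action and no missing mass, so almost surely the run is infinite and its word
is a member of the family. -/
theorem one_le_PSem {Q : Type} (A : NBA α Q) (hnN : n < N)
    (hx : ∀ i i' k, k < n → x i k = x i' k) (hc : ∀ i k, N ≤ k → x i k = x i N)
    (hL : ∀ i, x i ∈ A.language) (i₀ : I) :
    1 ≤ (branchingChain x n N).PSem A (0, i₀) := by
  let μ : (branchingChain x n N).Strategy :=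
    ⟨fun _ => PMF.pure (), fun h ⟨m, hm⟩ _ _ => hm⟩
  refine le_trans ?_ (le_iSup _ μ)
  have hp : IsProbabilityMeasure ((branchingChain x n N).law μ (0, i₀)) := by
    have := PMF.toMeasure.isProbabilityMeasure ((branchingChain x n N).next μ (0, i₀) [])
    unfold MDP.law
    infer_instance
  rw [← measure_univ (μ := (branchingChain x n N).law μ (0, i₀))]
  refine measure_mono_ae ?_
  filter_upwards [(branchingChain x n N).ae_prob_ne_zero μ (0, i₀),
    (branchingChain x n N).ae_exists_run μ (0, i₀) (sum_prob x n N)] with y hy hr _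
  obtain ⟨r, hr⟩ := hr
  refine ⟨r, ?_, hr⟩
  have := (path_spec hnN hx hc (MDP.stateSeq (0, i₀) r) (fun k => (r k).2.1) rfl
    (hy r hr)).2
  change (fun k => (r k).2.1) ∈ A.language
  rw [show (fun k => (r k).2.1) = x _ from funext this]
  exact hL _

end branchingChain

/-! ### Products and the common state of a GfM automaton -/

namespace MDP

variable {α S Act Q : Type} [Fintype α] [Fintype S] [Fintype Q]

open Classical in
theorem product_prob_getD (M : MDP α S Act) (A : NBA α Q) (p p' : S × Q)
    (m : Act × (α → S → Q)) (a : α) :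
    ((M.product A).prob p m a).getD 0 p' =
      if p'.2 = m.2 a p'.1 ∧ p'.2 ∈ A.δ p.2 a then (M.prob p.1 m.1 a).getD 0 p'.1 else 0 := by
  simp only [product]
  cases M.prob p.1 m.1 a <;> simp

theorem of_product_prob_ne_zero {M : MDP α S Act} {A : NBA α Q} {p p' : S × Q}
    {m : Act × (α → S → Q)} {a : α} (h : ((M.product A).prob p m a).getD 0 p' ≠ 0) :
    p'.2 ∈ A.δ p.2 a ∧ (M.prob p.1 m.1 a).getD 0 p'.1 ≠ 0 := by
  rw [product_prob_getD] at h
  split_ifs at h with h1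
  · exact ⟨h1.2, h⟩
  · exact absurd rfl h

open Classical in
-- The resolution `m.2` selects at most one automaton state per label and successor, so resolving
-- nondeterminism cannot make an event about `M` alone more likely.
theorem sum_product_prob_le (M : MDP α S Act) (A : NBA α Q) (p : S × Q)
    (m : Act × (α → S → Q)) (D : Set S) :
    ∑ t : α × (S × Q) with t.2.1 ∈ D, ((M.product A).prob p m t.1).getD 0 t.2 ≤
      ∑ a, ∑ s' with s' ∈ D, (M.prob p.1 m.1 a).getD 0 s' := by
  rw [Finset.sum_filter, Fintype.sum_prod_type]
  refine Finset.sum_le_sum fun a _ => ?_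
  rw [Fintype.sum_prod_type, Finset.sum_filter]
  refine Finset.sum_le_sum fun s' _ => ?_
  by_cases h : s' ∈ D
  · simp only [h, if_true, product_prob_getD]
    calc _ ≤ ∑ q', (if q' = m.2 a s' then (M.prob p.1 m.1 a).getD 0 s' else 0) := by
          refine Finset.sum_le_sum fun q' _ => ?_
          split_ifs <;> simp_all
      _ = _ := by simp
  · simp [h]

end MDP

/-- If all words of a family that agree on their first `n` letters are accepted by a good-for-MDPs
automaton, then there is a state that all of them can visit after `n` letters in an accepting
run. -/
theorem NBA.IsGfM.exists_common_state {α I Q : Type} [Fintype α] [Fintype I] [Nonempty I]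
    [Fintype Q] {A : NBA α Q} (hA : A.IsGfM) (x : I → ℕ → α) {n N : ℕ} (hnN : n < N)
    (hx : ∀ i i' k, k < n → x i k = x i' k) (hc : ∀ i k, N ≤ k → x i k = x i N)
    (hL : ∀ i, x i ∈ A.language) :
    ∃ q, ∀ i, ∃ ρ, A.IsRun (x i) ρ ∧ A.Buchi ρ ∧ ρ n = q := by
  classical
  by_contra! hbad
  choose bad hbad using hbad
  obtain ⟨i₀⟩ := ‹Nonempty I›
  have : Nonempty I := ⟨i₀⟩
  -- `c = 1 - 1/|I|` is the chance that the draw avoids one given index. It does not depend on the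
  -- strategy, so it also bounds the supremum.
  let c : ℝ≥0∞ := ((Fintype.card I - 1 : ℕ) : ℝ≥0∞) * (Fintype.card I : ℝ≥0∞)⁻¹
  have hc1 : c < 1 := by
    rw [← ENNReal.mul_inv_cancel (a := (Fintype.card I : ℝ≥0∞)) (by simp) (by simp)]
    refine ENNReal.mul_lt_mul_left (by simp) (by simp) ?_
    have := Fintype.card_pos (α := I)
    exact_mod_cast Nat.sub_lt this one_pos
  have h1 := branchingChain.one_le_PSem A hnN hx hc hL i₀
  rw [← hA] at h1
  refine absurd (h1.trans (iSup_le fun μ => ?_)) (not_le.2 hc1)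
  refine MDP.Pr_le _ μ _ n (fun p => {t | p.1.1.val = n ∧ t.2.1.2 ≠ bad p.2}) c ?_ _ ?_
  · intro p m
    by_cases hp : p.1.1.val = n
    · have e : ({t | p.1.1.val = n ∧ t.2.1.2 ≠ bad p.2} : Set (α × (Fin (N + 1) × I) × Q)) =
          {t | t.2.1 ∈ {s : Fin (N + 1) × I | s.2 ≠ bad p.2}} := by
        ext t; simp [hp]
      rw [e]
      refine (MDP.sum_product_prob_le (branchingChain x n N) A p m
        {s | s.2 ≠ bad p.2}).trans ?_
      simp only [branchingChain.prob_getD, hp, Finset.sum_filter, if_true]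
      rw [Finset.sum_comm]
      refine le_of_eq (Eq.trans (b := ∑ p' : Fin (N + 1) × I,
        if p'.1 = ⟨min (n + 1) N, Nat.lt_succ_of_le (min_le_right _ _)⟩ then
          (if p'.2 ≠ bad p.2 then (Fintype.card I : ℝ≥0∞)⁻¹ else 0) else 0)
        (Finset.sum_congr rfl fun p' _ => ?_) ?_)
      · by_cases h : p'.2 = bad p.2 <;> simp [h]
      rw [Fintype.sum_prod_type_right]
      simp only [Finset.sum_ite_eq', Finset.mem_univ, if_true]
      rw [← Finset.sum_filter, Finset.sum_const, Finset.filter_ne', Finset.card_erase_of_mem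
        (Finset.mem_univ _), Finset.card_univ, nsmul_eq_mul]
    · simp [hp]
  · intro r hr hpos
    have hM := fun k => MDP.of_product_prob_ne_zero (hpos k)
    let p : ℕ → (Fin (N + 1) × I) × Q := MDP.stateSeq ((0, i₀), A.init) r
    obtain ⟨hn, hw⟩ := branchingChain.path_spec hnN hx hc (fun k => (p k).1)
      (fun k => (r k).2.1) rfl (fun k => (hM k).2)
    -- If the index drawn were `bad` for the current automaton state, the automaton component would
    -- be an accepting run on that very word through that state.
    refine ⟨hn, fun hb => ?_⟩
    obtain ⟨f, hf, hfr⟩ := hr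
    refine hbad (p n).2 (fun k => (p k).2) ⟨rfl, fun k => ?_⟩ ⟨f.2, hf, ?_⟩ rfl
    · have := hw k
      rw [show (p (n + 1)).1.2 = bad (p n).2 from hb] at this
      rw [← this]
      exact (hM k).1
    · have : ∃ᶠ k in atTop, p (k + 1) = f := hfr
      exact (tendsto_add_atTop_nat 1).frequently
        (this.mono fun k hk => by simp [hk])

/-! ### The languages in terms of letter positions -/

/-- The words that have a prefix in `langFin n` after which the rest satisfies `P`. -/
theorem exists_langFin_iff {n : ℕ} (hn : 1 ≤ n) (P : (ℕ → Letter) → Prop) (x : ℕ → Letter) :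
    (∃ w ∈ langFin n, ∃ β, P β ∧ x = appendWord w β) ↔
      ∃ t, (∀ j < t + n, x j ≠ Letter.dollar) ∧ x t = Letter.one ∧
        x (t + n) = Letter.dollar ∧ P fun k => x (t + n + 1 + k) := by
  constructor
  · rintro ⟨w, ⟨u, v, hu, hv, hl, rfl⟩, β, hβ, rfl⟩
    refine ⟨u.length, fun j hj => ?_, ?_, ?_, ?_⟩
    · have hj' : j < (u ++ [Letter.one] ++ v).length := by simp; omega
      have hj2 : j < (u ++ [Letter.one] ++ v ++ [Letter.dollar]).length := by simp; omega
      have : (u ++ [Letter.one] ++ v)[j] ∈ u ++ [Letter.one] ++ v := List.getElem_mem hj'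
      simp only [appendWord]
      rw [List.getElem?_eq_getElem hj2, Option.getD_some, List.getElem_append_left hj']
      intro h
      rw [h] at this
      simp [hu, hv] at this
    · simp [appendWord]
    · simp only [appendWord]
      rw [List.getElem?_append_right (by simp; omega)]
      simp [show u.length + n - (u.length + (v.length + 1)) = 0 by omega]
    · convert hβ using 1
      funext k
      simp only [appendWord]
      rw [List.getElem?_eq_none (by simp; omega), Option.getD_none]
      congr 1; simp; omega
  · rintro ⟨t, h1, h2, h3, h4⟩
    let u := List.ofFn fun i : Fin t => x i
    let v := List.ofFn fun i : Fin (n - 1) => x (t + 1 + i)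
    refine ⟨u ++ [Letter.one] ++ v ++ [Letter.dollar], ⟨u, v, ?_, ?_, ?_, rfl⟩,
      fun k => x (t + n + 1 + k), h4, ?_⟩
    · intro h
      obtain ⟨i, hi⟩ := List.mem_ofFn.1 h
      exact h1 i (by omega) hi
    · intro h
      obtain ⟨i, hi⟩ := List.mem_ofFn.1 h
      exact h1 (t + 1 + i) (by omega) hi
    · simp [v]; omega
    · funext k
      have hlen : (u ++ [Letter.one] ++ v ++ [Letter.dollar]).length = t + n + 1 := by
        simp [u, v]; omega
      simp only [appendWord, hlen]
      rcases lt_or_ge k (t + n + 1) with hk | hk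
      · rcases lt_trichotomy k t with h | h | h
        · rw [List.append_assoc, List.append_assoc, List.getElem?_append_left (by simp [u]; omega)]
          simp [u, h]
        · subst h
          rw [List.append_assoc, List.append_assoc, List.getElem?_append_right (by simp [u])]
          simp [u, h2]
        · rcases Nat.lt_or_ge k (t + n) with h' | h'
          · rw [List.getElem?_append_left (by simp [u, v]; omega),
              List.getElem?_append_right (by simp [u]; omega)]
            simp only [u, v, List.length_append, List.length_ofFn, List.length_singleton]
            rw [List.getElem?_ofFn, dif_pos (by omega)]
            simp only [Option.getD_some]
            congr 1; omega
          · have : k = t + n := by omega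
            subst this
            rw [List.getElem?_append_right (by simp [u, v]; omega)]
            simp only [u, v, List.length_append, List.length_ofFn, List.length_singleton]
            rw [show t + n - (t + 1 + (n - 1)) = 0 by omega]
            simp [h3]
      · rw [List.getElem?_eq_none (by omega)]
        simp only [Option.getD_none]
        congr 1; omega

theorem mem_langR_iff {n : ℕ} (hn : 1 ≤ n) (x : ℕ → Letter) :
    x ∈ langR n ↔ ∃ t, (∀ j < t + n, x j ≠ Letter.dollar) ∧ x t = Letter.one ∧
      x (t + n) = Letter.dollar := by
  simpa only [true_and, and_true, langR, Set.mem_ofPred_eq] using exists_langFin_iff hn (fun _ => True) x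

theorem mem_langS_iff {n : ℕ} (hn : 1 ≤ n) (x : ℕ → Letter) :
    x ∈ langS n ↔ (∃ t, (∀ j < t + n, x j ≠ Letter.dollar) ∧ x t = Letter.one ∧
      ∀ j, t + n ≤ j → x j = Letter.dollar) ∨ ∀ j, x j ≠ Letter.dollar := by
  refine or_congr_left ?_
  have h := exists_langFin_iff hn (fun β => β = fun _ => Letter.dollar) x
  simp only [exists_eq_left] at h
  refine h.trans (exists_congr fun t => and_congr_right fun _ => and_congr_right fun _ => ?_)
  constructor
  · rintro ⟨h1, h2⟩ j hj
    rcases hj.eq_or_lt with rfl | hj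
    · exact h1
    · obtain ⟨d, rfl⟩ := Nat.exists_eq_add_of_le (Nat.succ_le_of_lt hj)
      exact congrFun h2 d
  · exact fun h1 => ⟨h1 _ le_rfl, funext fun k => h1 _ (by omega)⟩

/-- A word of letters other than `$` followed by `$` forever is in the reachability language iff it
is in the safety language iff the `n`-th last letter before the `$` is `1`. -/
theorem mem_lang_iff_of_dollar_iff {n m : ℕ} (hn : 1 ≤ n) (hm : n ≤ m) {x : ℕ → Letter}
    (hx : ∀ k, x k = Letter.dollar ↔ m ≤ k) {L : Set (ℕ → Letter)}
    (hL : L = langR n ∨ L = langS n) :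
    x ∈ L ↔ x (m - n) = Letter.one := by
  rcases hL with rfl | rfl
  · rw [mem_langR_iff hn]
    constructor
    · rintro ⟨t, h1, h2, h3⟩
      have h4 := (hx _).1 h3
      -- Together with `h4` this says that `t + n` is the position of the first `$`.
      have h5 : t + n ≤ m := by
        by_contra! h
        exact h1 m h ((hx m).2 le_rfl)
      rwa [show m - n = t by omega]
    · intro h
      refine ⟨m - n, fun j hj => ?_, h, (hx _).2 (by omega)⟩
      rw [Ne, hx]; omega
  · rw [mem_langS_iff hn]
    constructor
    · rintro (⟨t, h1, h2, h3⟩ | h)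
      · have h4 := (hx _).1 (h3 _ le_rfl)
        have h5 : t + n ≤ m := by
          by_contra! h
          exact h1 m h ((hx m).2 le_rfl)
        rwa [show m - n = t by omega]
      · exact absurd ((hx m).2 le_rfl) (h m)
    · intro h
      refine Or.inl ⟨m - n, fun j hj => ?_, h, fun j hj => (hx _).2 (by omega)⟩
      rw [Ne, hx]; omega

/-! ## The languages of the automata -/

/-- An accepting run is determined by the time `t` at which it leaves state 0: from then on the
automaton just counts to `n` and needs `$`. Conversely `t` can be guessed as the position of the
marked `1`. -/
theorem language_autR {n : ℕ} (hn : 1 ≤ n) : (autR n).language = langR n := by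
  ext x
  rw [mem_langR_iff hn]
  constructor
  · rintro ⟨ρ, ⟨h0, hρ⟩, f, rfl, hf⟩
    have hex : ∃ k, (ρ k).val ≠ 0 := by
      obtain ⟨k, hk⟩ := hf.exists
      exact ⟨k, by simp [hk]⟩
    classical
    obtain ⟨t, ht⟩ : ∃ t, Nat.find hex = t + 1 := Nat.exists_eq_succ_of_ne_zero fun h => by
      have := Nat.find_spec hex
      rw [h, h0] at this
      exact this rfl
    have hlt : ∀ j ≤ t, (ρ j).val = 0 := fun j hj => not_not.1 (Nat.find_min hex (by omega))
    have hne : (ρ (t + 1)).val ≠ 0 := ht ▸ Nat.find_spec hex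
    have hstep : ∀ k, _ := fun k => hρ k
    simp only [autR, Set.mem_ofPred_eq] at hstep
    have ht1 : x t = Letter.one ∧ (ρ (t + 1)).val = 1 := by
      have := hlt t le_rfl
      rcases hstep t with h | h | h | h | h
      all_goals first | exact ⟨h.2.1, h.2.2⟩ | omega
    have hpath : ∀ j < n, (ρ (t + 1 + j)).val = j + 1 := by
      intro j
      induction j with
      | zero => intro _; simpa using ht1.2
      | succ j ih =>
        intro hj
        have := ih (by omega)
        rcases hstep (t + 1 + j) with h | h | h | h | h
        all_goals first | omega | (rw [← add_assoc]; omega)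
    refine ⟨t, fun j hj => ?_, ht1.1, ?_⟩
    · rcases lt_trichotomy j t with h' | rfl | h'
      · have := hlt j h'.le
        have := hlt (j + 1) h'
        rcases hstep j with h | h | h | h | h
        all_goals first | exact h.2.1 | omega
      · rw [ht1.1]; simp
      · obtain ⟨d, rfl⟩ := Nat.exists_eq_add_of_le (Nat.succ_le_of_lt h')
        have := hpath d (by omega)
        rcases hstep (t + 1 + d) with h | h | h | h | h
        all_goals first | exact h.2.2.1 | omega
    · have := hpath (n - 1) (by omega)
      have e : t + 1 + (n - 1) = t + n := by omega
      rw [e] at this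
      rcases hstep (t + n) with h | h | h | h | h
      all_goals first | exact h.2.1 | omega
  · rintro ⟨t, h1, h2, h3⟩
    refine ⟨fun k => ⟨if k ≤ t then 0 else min (k - t) (n + 1), by split_ifs <;> omega⟩,
      ⟨by simp [autR], fun k => ?_⟩, Fin.last (n + 1), rfl, ?_⟩
    · simp only [autR, Set.mem_ofPred_eq]
      rcases lt_trichotomy k t with h | rfl | h
      · left
        exact ⟨if_pos h.le, h1 k (by omega), if_pos h⟩
      · right; left
        refine ⟨if_pos le_rfl, h2, ?_⟩
        rw [if_neg (by omega)]; omega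
      · rw [if_neg (by omega), if_neg (by omega)]
        rcases lt_trichotomy (k - t) n with h' | h' | h'
        · right; right; left
          exact ⟨by omega, by omega, h1 k (by omega), by omega⟩
        · right; right; right; left
          refine ⟨by omega, ?_, by omega⟩
          rw [show k = t + n by omega, h3]
        · right; right; right; right
          omega
    · refine (eventually_atTop.2 ⟨t + n + 1, fun k hk => ?_⟩).frequently
      ext
      simp only [Fin.val_last]
      rw [if_neg (by omega)]; omega

/-- Every run is accepting, by finiteness of the state set. Runs that stay in state 0 account for
the words without `$`; a run that leaves it counts to `n`, where only `$` can be read. -/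
theorem language_autS {n : ℕ} (hn : 1 ≤ n) : (autS n).language = langS n := by
  ext x
  rw [mem_langS_iff hn]
  have hB : ∀ ρ, (autS n).Buchi ρ := by
    intro ρ
    have h : ∃ᶠ i : ℕ in atTop, ∃ q, ρ i = q := (Eventually.of_forall fun i => ⟨_, rfl⟩).frequently
    obtain ⟨q, hq⟩ := frequently_exists.1 h
    exact ⟨q, trivial, hq⟩
  constructor
  · rintro ⟨ρ, ⟨h0, hρ⟩, -⟩
    have hstep : ∀ k, _ := fun k => hρ k
    simp only [autS, Set.mem_ofPred_eq] at hstep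
    by_cases hex : ∃ k, (ρ k).val ≠ 0
    · left
      classical
      obtain ⟨t, ht⟩ : ∃ t, Nat.find hex = t + 1 := Nat.exists_eq_succ_of_ne_zero fun h => by
        have := Nat.find_spec hex
        rw [h, h0] at this
        exact this rfl
      have hlt : ∀ j ≤ t, (ρ j).val = 0 := fun j hj => not_not.1 (Nat.find_min hex (by omega))
      have hne : (ρ (t + 1)).val ≠ 0 := ht ▸ Nat.find_spec hex
      have ht1 : x t = Letter.one ∧ (ρ (t + 1)).val = 1 := by
        have := hlt t le_rfl
        rcases hstep t with h | h | h | h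
        all_goals first | exact ⟨h.2.1, h.2.2⟩ | omega
      have hpath : ∀ j, (ρ (t + 1 + j)).val = min (j + 1) n := by
        intro j
        induction j with
        | zero => simp [ht1.2]; omega
        | succ j ih =>
          rcases hstep (t + 1 + j) with h | h | h | h
          all_goals first | omega | (rw [← add_assoc]; omega)
      refine ⟨t, fun j hj => ?_, ht1.1, fun j hj => ?_⟩
      · rcases lt_trichotomy j t with h' | rfl | h'
        · have := hlt j h'.le
          have := hlt (j + 1) h'
          rcases hstep j with h | h | h | h
          all_goals first | exact h.2.1 | omega
        · rw [ht1.1]; simp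
        · obtain ⟨d, rfl⟩ := Nat.exists_eq_add_of_le (Nat.succ_le_of_lt h')
          have := hpath d
          rcases hstep (t + 1 + d) with h | h | h | h
          all_goals first | exact h.2.2.1 | omega
      · obtain ⟨d, rfl⟩ := Nat.exists_eq_add_of_le (show t + 1 ≤ j by omega)
        have := hpath d
        rcases hstep (t + 1 + d) with h | h | h | h
        all_goals first | exact h.2.1 | omega
    · right
      push Not at hex
      intro j
      have := hex j
      have := hex (j + 1)
      rcases hstep j with h | h | h | h
      all_goals first | exact h.2.1 | omega
  · rintro (⟨t, h1, h2, h3⟩ | h)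
    · refine ⟨fun k => ⟨if k ≤ t then 0 else min (k - t) n, by split_ifs <;> omega⟩,
        ⟨by simp [autS], fun k => ?_⟩, hB _⟩
      simp only [autS, Set.mem_ofPred_eq]
      rcases lt_trichotomy k t with h | rfl | h
      · left
        exact ⟨if_pos h.le, h1 k (by omega), if_pos h⟩
      · right; left
        refine ⟨if_pos le_rfl, h2, ?_⟩
        rw [if_neg (by omega)]; omega
      · rw [if_neg (by omega), if_neg (by omega)]
        rcases lt_or_ge (k - t) n with h' | h'
        · right; right; left
          exact ⟨by omega, by omega, h1 k (by omega), by omega⟩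
        · right; right; right
          exact ⟨by omega, h3 k (by omega), by omega⟩
    · exact ⟨fun _ => 0, ⟨rfl, fun k => Or.inl ⟨rfl, h k, rfl⟩⟩, hB _⟩

/-- For each state and each of the three letters, the only possible targets are 0 and the next
state, capped at `n + 1`. -/
theorem numTransitions_autR_le (n : ℕ) : (autR n).numTransitions ≤ 6 * (n + 2) := by
  let g : Fin (n + 2) × Letter × Bool → Fin (n + 2) × Letter × Fin (n + 2) := fun t =>
    (t.1, t.2.1, if t.2.2 then 0 else ⟨min (t.1.val + 1) (n + 1), by omega⟩)
  have hsub : {t : Fin (n + 2) × Letter × Fin (n + 2) | t.2.2 ∈ (autR n).δ t.1 t.2.1} ⊆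
      Set.range g := by
    rintro ⟨q, a, p⟩ h
    by_cases hp : p.val = 0
    · exact ⟨(q, a, true), by simp [g]; ext; simp [hp]⟩
    · refine ⟨(q, a, false), ?_⟩
      simp only [g, Bool.false_eq_true, if_false, Prod.mk.injEq, true_and]
      ext
      simp only [autR, Set.mem_ofPred_eq] at h
      simp only
      omega
  refine (Set.ncard_le_ncard hsub).trans ?_
  rw [← Nat.card_coe_set_eq]
  refine (Finite.card_range_le g).trans ?_
  rw [Nat.card_eq_fintype_card]
  simp only [Fintype.card_prod, Fintype.card_fin, Fintype.card_bool]
  have h3 : Fintype.card Letter = 3 := rfl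
  rw [h3]
  omega

/-! ## The lower bound -/

/-- Two accepting runs that are in the same state after `n` steps can be spliced. -/
theorem NBA.mem_language_of_splice {α Q : Type} {A : NBA α Q} {x x' : ℕ → α} {ρ ρ' : ℕ → Q}
    {n : ℕ} (hρ : A.IsRun x ρ) (hρ' : A.IsRun x' ρ') (hB : A.Buchi ρ') (h : ρ n = ρ' n) :
    (fun k => if k < n then x k else x' k) ∈ A.language := by
  refine ⟨fun k => if k < n then ρ k else ρ' k, ⟨?_, fun k => ?_⟩, ?_⟩
  · rcases Nat.eq_zero_or_pos n with rfl | hn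
    · simpa using hρ'.1
    · simpa [hn] using hρ.1
  · rcases lt_trichotomy (k + 1) n with hk | hk | hk
    · simpa [hk, Nat.lt_of_succ_lt hk] using hρ.2 k
    · have := hρ.2 k
      rw [hk, h] at this
      simpa [hk, show k < n by omega] using this
    · simpa [show ¬ k < n by omega, show ¬ k + 1 < n by omega] using hρ'.2 k
  · obtain ⟨f, hf, hfr⟩ := hB
    refine ⟨f, hf, (hfr.and_eventually (eventually_ge_atTop n)).mono fun k hk => ?_⟩
    simpa [not_lt.2 hk.2] using hk.1

/-- The word `u c 0^(m-1) $^ω`, where the letter `c` is `1` if `b` is true and `0` otherwise; for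
`m = 0` it is `u $^ω`. -/
def testWord {n : ℕ} (u : Fin n → Bool) (b : Bool) (m k : ℕ) : Letter :=
  if h : k < n then (if u ⟨k, h⟩ then .one else .zero)
  else if k < n + m then (if b ∧ k = n then .one else .zero) else .dollar

theorem testWord_eq_dollar_iff {n : ℕ} (u : Fin n → Bool) (b : Bool) (m k : ℕ) :
    testWord u b m k = .dollar ↔ n + m ≤ k := by
  unfold testWord
  split_ifs <;> simp <;> omega

theorem testWord_mem_iff {n : ℕ} (hn : 1 ≤ n) (u : Fin n → Bool) (b : Bool) (m : ℕ)
    {L : Set (ℕ → Letter)} (hL : L = langR n ∨ L = langS n) :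
    testWord u b m ∈ L ↔ testWord u b m m = .one := by
  rw [mem_lang_iff_of_dollar_iff hn (Nat.le_add_right n m) (testWord_eq_dollar_iff u b m) hL,
    Nat.add_sub_cancel_left]

/-- The first `$` is at `n + i`, so the decisive letter is bit `i` of `u`. -/
theorem testWord_false_mem_iff {n : ℕ} (u : Fin n → Bool) (i : Fin n)
    {L : Set (ℕ → Letter)} (hL : L = langR n ∨ L = langS n) :
    testWord u false i ∈ L ↔ u i := by
  rw [testWord_mem_iff (Nat.one_le_iff_ne_zero.2 (by have := i.2; omega)) u false i hL]
  simp [testWord]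

/-- Here the decisive letter is the appended one at position `n`, so `u` plays no role. -/
theorem testWord_self_mem_iff {n : ℕ} (hn : 1 ≤ n) (u : Fin n → Bool) (b : Bool)
    {L : Set (ℕ → Letter)} (hL : L = langR n ∨ L = langS n) :
    testWord u b n ∈ L ↔ b := by
  rw [testWord_mem_iff hn u b n hL]
  simp [testWord, Nat.pos_of_ne_zero (Nat.one_le_iff_ne_zero.1 hn)]

/-- After reading the finite word `u`, a good-for-MDPs automaton can be in a state from which it
accepts everything that has to be accepted. -/
theorem NBA.IsGfM.exists_state_after {n : ℕ} (hn : 1 ≤ n) {Q : Type} [Fintype Q]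
    {A : NBA Letter Q} (hA : A.IsGfM) (hL : A.language = langR n ∨ A.language = langS n)
    (u : Fin n → Bool) :
    ∃ q, (∃ ρ, A.IsRun (testWord u true n) ρ ∧ A.Buchi ρ ∧ ρ n = q) ∧
      ∀ i, u i → ∃ ρ, A.IsRun (testWord u false i) ρ ∧ A.Buchi ρ ∧ ρ n = q := by
  have hmem : testWord u true n ∈ A.language := (testWord_self_mem_iff hn u true hL).2 rfl
  -- For `u i` false the query word is outside the language; the always accepted word stands in for
  -- it, so that the whole family is accepted.
  let x : Option (Fin n) → ℕ → Letter := fun o =>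
    o.elim (testWord u true n) fun i => if u i then testWord u false i else testWord u true n
  have hx : ∀ o, ∃ b m, m ≤ n ∧ x o = testWord u b m := by
    rintro (_ | i)
    · exact ⟨true, n, le_rfl, rfl⟩
    · by_cases h : u i
      · exact ⟨false, i, i.2.le, if_pos h⟩
      · exact ⟨true, n, le_rfl, if_neg h⟩
  -- Each continuation has at most `n` letters before its `$^ω`, so all words are constant from `n +
  -- n` on.
  obtain ⟨q, hq⟩ := hA.exists_common_state x (n := n) (N := n + n) (by omega)
    (fun o o' k hk => by
      obtain ⟨b, m, -, h⟩ := hx o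
      obtain ⟨b', m', -, h'⟩ := hx o'
      rw [h, h']
      simp [testWord, hk])
    (fun o k hk => by
      obtain ⟨b, m, hm, h⟩ := hx o
      rw [h, (testWord_eq_dollar_iff u b m k).2 (by omega),
        (testWord_eq_dollar_iff u b m _).2 (by omega)])
    (by
      rintro (_ | i)
      · exact hmem
      · by_cases h : u i
        · simpa [x, h] using (testWord_false_mem_iff u i hL).2 h
        · simpa [x, h] using hmem)
  refine ⟨q, hq none, fun i hi => ?_⟩
  have := hq (some i)
  simpa only [x, Option.elim_some, if_pos hi] using this

theorem NBA.IsGfM.two_pow_le_card {n : ℕ} (hn : 1 ≤ n) {Q : Type} [Fintype Q]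
    {A : NBA Letter Q} (hA : A.IsGfM) (hL : A.language = langR n ∨ A.language = langS n) :
    2 ^ n ≤ Nat.card {q : Q // ¬ A.IsSink q} := by
  choose q hq1 hq2 using hA.exists_state_after hn hL
  have hsink : ∀ u, ¬ A.IsSink (q u) := by
    intro u hs
    obtain ⟨ρ, hρ, hB, h⟩ := hq1 u
    have hconst : ∀ k, ρ (n + k) = q u := by
      intro k
      induction k with
      | zero => exact h
      | succ k ih =>
        have := hρ.2 (n + k)
        rw [ih, hs] at this
        exact this
    -- A sink ignores its input, so the same `ρ` accepts the word with `1` replaced by `0` at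
    -- position `n`, which is not in the language.
    have : testWord u false n ∈ A.language := by
      refine ⟨ρ, ⟨hρ.1, fun k => ?_⟩, hB⟩
      rcases lt_or_ge k n with hk | hk
      · have := hρ.2 k
        simpa [testWord, hk] using this
      · obtain ⟨d, rfl⟩ := Nat.exists_eq_add_of_le hk
        rw [hconst, add_assoc, hconst, hs]
        rfl
    simpa using (testWord_self_mem_iff hn u false hL).1 this
  have hinj : ∀ u u' i, q u = q u' → u i → u' i := by
    intro u u' i e hi
    obtain ⟨ρ, hρ, hB, h⟩ := hq2 u i hi
    obtain ⟨ρ', hρ', -, h'⟩ := hq1 u'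
    -- The spliced word is `u' 0^i $^ω`. The run on `u' 1 0^(n-1) $^ω` supplies the prefix, since it
    -- exists even if `u'` has no true bit.
    have := NBA.mem_language_of_splice hρ' hρ hB (by rw [h, h', e])
    rw [← testWord_false_mem_iff u' i hL]
    convert this using 2 with k
    by_cases hk : k < n <;> simp [testWord, hk]
  have hcard : Nat.card (Fin n → Bool) = 2 ^ n := by simp
  rw [← hcard]
  refine Nat.card_le_card_of_injective (fun u => (⟨q u, hsink u⟩ : {q : Q // ¬ A.IsSink q})) ?_
  intro u u' e
  have e' : q u = q u' := congrArg Subtype.val e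
  funext i
  exact Bool.eq_iff_iff.2 ⟨hinj u u' i e', hinj u' u i e'.symm⟩

theorem isReachability_autR {n : ℕ} (hn : 1 ≤ n) : (autR n).IsReachability := by
  refine ⟨Fin.last (n + 1), rfl, fun a => ?_⟩
  ext p
  simp only [autR, Set.mem_ofPred_eq, Set.mem_singleton_iff, Fin.ext_iff, Fin.val_last]
  constructor
  · rintro (h | h | h | h | h) <;> omega
  · exact fun h => Or.inr (Or.inr (Or.inr (Or.inr ⟨trivial, h⟩)))

theorem mainTheorem5 :
    (∀ n : ℕ, 1 ≤ n →
      ((autR n).IsReachability ∧ Fintype.card (Fin (n + 2)) = n + 2 ∧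
        (autR n).language = langR n) ∧
      ((autS n).IsSafety ∧ Fintype.card (Fin (n + 1)) = n + 1 ∧
        (autS n).language = langS n) ∧
      (∀ (Q : Type) [Fintype Q] (A : NBA Letter Q), A.IsGfM →
        (A.language = langR n ∨ A.language = langS n) →
        2 ^ n ≤ Nat.card {q : Q // ¬ A.IsSink q})) ∧
    (∃ c : ℝ, 0 < c ∧ ∀ᶠ m : ℕ in atTop,
      ∃ (k : ℕ) (N : NBA Letter (Fin k)), k ≤ m ∧ N.numTransitions ≤ m ∧
        ∀ (Q : Type) [Fintype Q] (A : NBA Letter Q), A.IsGfM → A.language = N.language →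
          (2 : ℝ) ^ (c * m) ≤ Fintype.card Q) := by
  refine ⟨fun n hn => ⟨⟨isReachability_autR hn, Fintype.card_fin _, language_autR hn⟩,
    ⟨rfl, Fintype.card_fin _, language_autS hn⟩,
    fun Q _ A hA hL => hA.two_pow_le_card hn hL⟩, 1 / 24, by norm_num, ?_⟩
  -- With `n = m / 12` rounded down, `m ≥ 24` gives both `6 * (n + 2) ≤ m` and `m ≤ 24 * n`; the
  -- latter is the source of `c = 1 / 24`.
  filter_upwards [eventually_ge_atTop 24] with m hm
  have hn : 1 ≤ m / 12 := by omega
  refine ⟨m / 12 + 2, autR (m / 12), by omega,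
    (numTransitions_autR_le _).trans (by omega), fun Q _ A hA hL => ?_⟩
  rw [language_autR hn] at hL
  have h1 : 2 ^ (m / 12) ≤ Fintype.card Q := by
    rw [← Nat.card_eq_fintype_card]
    exact (hA.two_pow_le_card hn (Or.inl hL)).trans (Finite.card_subtype_le _)
  have h2 : (1 / 24 * m : ℝ) ≤ (m / 12 : ℕ) := by
    have : (m : ℝ) ≤ 24 * (m / 12 : ℕ) := by
      exact_mod_cast (by omega : m ≤ 24 * (m / 12))
    linarith
  calc (2 : ℝ) ^ (1 / 24 * m : ℝ) ≤ (2 : ℝ) ^ ((m / 12 : ℕ) : ℝ) :=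
        Real.rpow_le_rpow_of_exponent_le (by norm_num) h2
    _ = ((2 ^ (m / 12) : ℕ) : ℝ) := by rw [Real.rpow_natCast]; push_cast; rfl
    _ ≤ Fintype.card Q := by exact_mod_cast h1
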